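/- **Setting.** Let $n\ge 1$ and work in $\mathbb Z[x_1,\dots,x_n]$ with $x_1\prec\dots\prec x_n$. For polynomials in $k$ variables, content, primitive part, coefficients, discriminant and resultant are taken with respect to the main variable $x_k$. An *irreducible basis* is a finite set of irreducible, pairwise relatively prime polynomials of positive degree in the main variable. A polynomial $f$ in $k$ variables is *nullified* at $\alpha\in\mathbb R^{k-1}$ if $f(\alpha,x_k)$ is the zero polynomial, and nullified on a cell $c\subseteq\mathbb R^{k-1}$ if it is nullified at every point of $c$. For a finite set $A$ of polynomials let $\mathrm{bas}(A)$ be the set of irreducible factors (up to sign) of the primitive parts of the elements of $A$. McCallum's operator is $$P(A)=\mathrm{cont}(A)\cup\mathrm{coeff}(B)\cup\mathrm{disc}(B)\cup\{\mathrm{res}(f,g): f,g\in B,\ f\ne g\},\qquad B=\mathrm{bas}(A).$$ **Input.** Let $\phi_1,\dots,\phi_t$ be quantifier-free Tarski formulae in $x_1,\dots,x_n$, let $A_i$ be the set of polynomials occurring in $\phi_i$, and assume that each $A_i$ is an irreducible basis. Each $\phi_i$ has at most one designated equational constraint $f_i=0$ (that is, $f_i\in A_i$ and $\phi_i$ implies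 $f_i=0$). Put $E_i=\{f_i\}$ if $\phi_i$ has a designated constraint and $E_i=A_i$ otherwise, and $E=\bigcup_iE_i$. The *ResCAD set* is $$\mathcal R=E\cup\bigcup_{i=1}^t\{\mathrm{res}_{x_n}(f,g): f\in E_i,\ g\in A_i\setminus E_i\}.$$ **$P$-algorithms.** A *$P$-algorithm* $W$ is a projection and lifting procedure of the following kind. Its output is either FAIL or a list of cells, each given by its index, a sample point and the subset of $\mathbb R^k$ that it denotes. For $k=0$ it returns the one-point cell. On a finite set $A$ of polynomials in $k\ge1$ variables it runs itself on $P(A)$ in $k-1$ variables, where $P(A)$ may first be simplified by adding or removing constants and duplicates and by replacing polynomials by non-zero constant multiples. It then replaces each cell $c$ obtained by the stack over $c$ of the polynomials in $\mathrm{bas}(A)$, if none of them is nullified on $c$. If one of them is nullified on $c$, it either fails or lifts with a substitute set of polynomials, according to a rule that belongs to $W$. The choice of sample points also belongs to $W$. The algorithm CADW is a $P$-algorithm which, if an element of $\mathrm{bas}(A)$ is nullified on $c$, fails when $\dim c>0$, and when $\dim c=0$ replaces each nullified $f$ by a delineating polynomial. That is a polynomial which is not nullified at the point of $c$ and in each of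 whose sections and sectors over this point $f$ has constant order of vanishing. **Algorithm 1.** Let $F_i=\mathrm{bas}(E_i)$ and $B_i=\mathrm{bas}(A_i)$. If $n=1$, the TTICAD algorithm (Algorithm 1) returns the decomposition of $\mathbb R$ by the real roots of $\bigcup_iF_i$. If $n>1$, it runs its subalgorithm (a $P$-algorithm $K$, normally CADW) in $n-1$ variables on the set $$\bigcup_i\mathrm{cont}(A_i)\ \cup\ \bigcup_i\bigl(\mathrm{coeff}(F_i)\cup\mathrm{disc}(F_i)\cup\mathrm{res}(F_i)\cup\{\mathrm{res}(f,g):f\in F_i,\,g\in B_i\setminus F_i\}\bigr)\ \cup\ \{\mathrm{res}(f,\hat f): f\in F_i,\ \hat f\in F_j,\ i<j,\ f\ne\hat f\},$$ and fails if $K$ does. Here $\mathrm{res}(F_i)=\{\mathrm{res}(f,g): f,g\in F_i,\ f\neq g\}$. It then replaces each cell $c$ by the stack over $c$ of $\bigcup_iL_i$, where $L_i=F_i$ if no $f\in E_i$ is nullified on $c$. If some $f\in E_i$ is nullified on $c$, it fails when $\dim c>0$, and uses $L_i=B_i$ when $\dim c=0$. Sample points are chosen as $K$ chooses them. **Statement.**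 Suppose that no $f\in E$ is nullified at a point of $\mathbb R^{n-1}$. Then: 1. For every $P$-algorithm $W$, the output of $W$ on $\mathcal R$ is the same (the same list of cells, or FAIL in both cases) as the output of Algorithm 1 on $\phi_1,\dots,\phi_t$ with subalgorithm $W$. In particular, CADW on $\mathcal R$ returns the TTICAD that Algorithm 1 returns. 2. Let $W$ be a $P$-algorithm and let $K$ be CADW (for some choice of delineating polynomials). Suppose that $W$ chooses sample points as $K$ does and, on a cell on which a basis polynomial is nullified, either fails or proceeds as $K$ does. If $W$ returns a decomposition $\mathcal D$ on input $\mathcal R$, then Algorithm 1 with subalgorithm $K$ returns $\mathcal D$ on $\phi_1,\dots,\phi_t$. -/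

import Mathlib

namespace TTICAD

/-- Integral polynomials in `x₁ ≺ ⋯ ≺ xₙ`; the variable `xₖ` has index `k - 1`. -/
abbrev Poly (n : ℕ) : Type := MvPolynomial (Fin n) ℤ

/-- `ℤ[x₁, …, xₙ]` is a UFD, so greatest common divisors exist and every class of associates has
a chosen representative. -/
noncomputable instance instNormalizedGCDMonoidPoly (n : ℕ) : NormalizedGCDMonoid (Poly n) :=
  letI : StrongNormalizationMonoid (Poly n) := UniqueFactorizationMonoid.strongNormalizationMonoid
  UniqueFactorizationMonoid.toNormalizedGCDMonoid (Poly n)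

/-- A polynomial in `n + 1` variables read as a polynomial in its main variable (the last one). -/
noncomputable def toMain (R : Type) [CommRing R] (n : ℕ) :
    MvPolynomial (Fin (n + 1)) R ≃ₐ[R] Polynomial (MvPolynomial (Fin n) R) :=
  (MvPolynomial.renameEquiv R finSuccEquivLast).trans (MvPolynomial.optionEquivLeft R (Fin n))

section Algebra

variable {n : ℕ}

noncomputable def mainDegree (f : Poly (n + 1)) : ℕ := (toMain ℤ n f).natDegree

noncomputable def cont (f : Poly (n + 1)) : Poly n := (toMain ℤ n f).content

noncomputable def prim (f : Poly (n + 1)) : Poly (n + 1) := (toMain ℤ n).symm (toMain ℤ n f).primPart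

noncomputable def disc (f : Poly (n + 1)) : Poly n := (toMain ℤ n f).discr

noncomputable def res (f g : Poly (n + 1)) : Poly n := (toMain ℤ n f).resultant (toMain ℤ n g)

/-- The non-zero coefficients with respect to the main variable. -/
noncomputable def coeffs (f : Poly (n + 1)) : Finset (Poly n) := (toMain ℤ n f).coeffs

/-- A polynomial in `n` variables regarded as a polynomial in `n + 1` variables. -/
noncomputable def embed (r : Poly n) : Poly (n + 1) := MvPolynomial.rename Fin.castSucc r

structure IsIrreducibleBasis (A : Finset (Poly (n + 1))) : Prop where
  pos_degree : ∀ f ∈ A, 0 < mainDegree f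
  irreducible : ∀ f ∈ A, Irreducible f
  relPrime : ∀ f ∈ A, ∀ g ∈ A, f ≠ g → IsRelPrime f g

open scoped Classical in
/-- The finest squarefree basis of the primitive parts of the elements of `A`: all their
irreducible factors, one from each class of associates. -/
noncomputable def basis (A : Finset (Poly (n + 1))) : Finset (Poly (n + 1)) :=
  A.biUnion fun f => (UniqueFactorizationMonoid.normalizedFactors (prim f)).toFinset

open scoped Classical in
/-- `{res(f, g) | f ∈ A, g ∈ B, f ≠ g}`. -/
noncomputable def resSet (A B : Finset (Poly (n + 1))) : Finset (Poly n) :=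
  ((A ×ˢ B).filter fun p => p.1 ≠ p.2).image fun p => res p.1 p.2

open scoped Classical in
/-- McCallum's projection of an irreducible basis: coefficients, discriminants, resultants. -/
noncomputable def projBasis (B : Finset (Poly (n + 1))) : Finset (Poly n) :=
  B.biUnion coeffs ∪ B.image disc ∪ resSet B B

open scoped Classical in
/-- McCallum's projection operator `P` on an arbitrary finite set of polynomials. -/
noncomputable def projP (A : Finset (Poly (n + 1))) : Finset (Poly n) :=
  A.image cont ∪ projBasis (basis A)

open scoped Classical in
/-- The reduced projection `P_E(A)` of an irreducible basis `A` relative to a subset `E`. -/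
noncomputable def projEC (E A : Finset (Poly (n + 1))) : Finset (Poly n) :=
  projBasis E ∪ resSet E (A \ E)

open scoped Classical in
/-- The cross resultant set of a list of sets. -/
noncomputable def crossRes {t : ℕ} (E : Fin t → Finset (Poly (n + 1))) : Finset (Poly n) :=
  Finset.univ.biUnion fun i => (Finset.Ioi i).biUnion fun j => resSet (E i) (E j)

open scoped Classical in
/-- The reduced projection of the list `A` of irreducible bases with respect to the list `E`. -/
noncomputable def projTTI {t : ℕ} (E A : Fin t → Finset (Poly (n + 1))) : Finset (Poly n) :=
  (Finset.univ.biUnion fun i => projEC (E i) (A i)) ∪ crossRes E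

/-- `p` and `q` agree up to a non-zero rational factor. -/
def ConstMultiple (p q : Poly n) : Prop :=
  ∃ a b : ℤ, a ≠ 0 ∧ b ≠ 0 ∧ MvPolynomial.C a * p = MvPolynomial.C b * q

def IsConstant (p : Poly n) : Prop := ∃ a : ℤ, p = MvPolynomial.C a

/-- `Q` and `Q'` agree up to trivial simplifications: presence of constants, and replacement of
polynomials by constant multiples. -/
def TrivEquiv (Q Q' : Finset (Poly n)) : Prop :=
  (∀ q ∈ Q, ¬ IsConstant q → ∃ q' ∈ Q', ConstMultiple q q') ∧
  (∀ q' ∈ Q', ¬ IsConstant q' → ∃ q ∈ Q, ConstMultiple q q')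

end Algebra

/-- Quantifier-free Tarski formulae. -/
inductive QFF (n : ℕ) : Type
  | eqZero (f : Poly n) : QFF n
  | pos (f : Poly n) : QFF n
  | neg (f : Poly n) : QFF n
  | not (φ : QFF n) : QFF n
  | and (φ ψ : QFF n) : QFF n
  | or (φ ψ : QFF n) : QFF n
  | imp (φ ψ : QFF n) : QFF n

namespace QFF

def Holds {n : ℕ} (x : Fin n → ℝ) : QFF n → Prop
  | eqZero f => MvPolynomial.aeval x f = 0
  | pos f => 0 < MvPolynomial.aeval x f
  | neg f => MvPolynomial.aeval x f < 0
  | not φ => ¬ φ.Holds x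
  | and φ ψ => φ.Holds x ∧ ψ.Holds x
  | or φ ψ => φ.Holds x ∨ ψ.Holds x
  | imp φ ψ => φ.Holds x → ψ.Holds x

open scoped Classical in
/-- The set of all polynomials occurring in a formula. -/
noncomputable def polys {n : ℕ} : QFF n → Finset (Poly n)
  | eqZero f => {f}
  | pos f => {f}
  | neg f => {f}
  | not φ => φ.polys
  | and φ ψ => φ.polys ∪ ψ.polys
  | or φ ψ => φ.polys ∪ ψ.polys
  | imp φ ψ => φ.polys ∪ ψ.polys

end QFF

/-- A quantifier-free formula with at most one designated equational constraint `f = 0`, where `f`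
occurs in the formula. -/
structure Clause (n : ℕ) where
  formula : QFF (n + 1)
  ec : Option (Poly (n + 1))
  ec_mem : ∀ f ∈ ec, f ∈ formula.polys
  ec_pos_degree : ∀ f ∈ ec, 0 < mainDegree f
  ec_implied : ∀ f ∈ ec, ∀ x : Fin (n + 1) → ℝ, formula.Holds x → MvPolynomial.aeval x f = 0

namespace Clause

variable {n : ℕ}

/-- The set `Aᵢ`. -/
noncomputable def A (φ : Clause n) : Finset (Poly (n + 1)) := φ.formula.polys

/-- The set `Eᵢ`: the designated constraint polynomial if there is one, and `Aᵢ` otherwise. -/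
noncomputable def E (φ : Clause n) : Finset (Poly (n + 1)) :=
  match φ.ec with
  | some f => {f}
  | none => φ.A

end Clause

open scoped Classical in
/-- The ResCAD set of a list of formulae. -/
noncomputable def resCAD {n t : ℕ} (φ : Fin t → Clause n) : Finset (Poly (n + 1)) :=
  (Finset.univ.biUnion fun i => (φ i).E) ∪
    (Finset.univ.biUnion fun i =>
      (((φ i).E ×ˢ ((φ i).A \ (φ i).E)).image fun p => embed (res p.1 p.2)))

section Lifting

variable {n : ℕ}

/-- The univariate polynomial `g(α, xₙ₊₁)`. -/
noncomputable def slice (g : MvPolynomial (Fin (n + 1)) ℝ) (α : Fin n → ℝ) : Polynomial ℝ :=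
  (toMain ℝ n g).map (MvPolynomial.eval α)

noncomputable def toReal (f : Poly n) : MvPolynomial (Fin n) ℝ :=
  MvPolynomial.map (Int.castRingHom ℝ) f

open scoped Classical in
noncomputable def realSet (L : Finset (Poly n)) : Finset (MvPolynomial (Fin n) ℝ) := L.image toReal

/-- `f` vanishes identically at `α`. -/
def NullifiedAt (f : Poly (n + 1)) (α : Fin n → ℝ) : Prop := slice (toReal f) α = 0

open scoped Classical in
/-- The real roots over `α` of the polynomials in `L` (those nullified at `α` contribute none). -/
noncomputable def rootsOver (L : Finset (MvPolynomial (Fin (n + 1)) ℝ)) (α : Fin n → ℝ) :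
    Finset ℝ :=
  L.biUnion fun g => (slice g α).roots.toFinset

open scoped Classical in
/-- Position of `y` in the decomposition of the line by `S`: with `s₁ < ⋯ < sₖ` the elements of
`S`, the point `sᵢ` has position `2 i` and the open intervals, from left to right, have positions
`1, 3, …, 2 k + 1`. -/
noncomputable def position (S : Finset ℝ) (y : ℝ) : ℕ :=
  if y ∈ S then 2 * (S.filter (· < y)).card + 2 else 2 * (S.filter (· < y)).card + 1

/-- A cell: its index, a sample point, and the subset of `ℝⁿ` that it denotes. -/
structure Cell (n : ℕ) where
  index : Fin n → ℕ
  sample : Fin n → ℝ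
  region : Set (Fin n → ℝ)
  sample_mem : sample ∈ region

/-- The dimension of a cell: the number of levels at which it is a sector (odd index). -/
def Cell.dim (c : Cell n) : ℕ := (Finset.univ.filter fun i => Odd (c.index i)).card

/-- The only cell of `ℝ⁰`. -/
def Cell.point : Cell 0 := ⟨Fin.elim0, Fin.elim0, Set.univ, Set.mem_univ _⟩

/-- `f` is nullified on the cell `c`. -/
def NullifiedOn (f : Poly (n + 1)) (c : Cell n) : Prop := ∀ α ∈ c.region, NullifiedAt f α

/-- The order of vanishing of `f` at `x`: the least degree of a term of `f(x + T)`. -/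
noncomputable def orderAt (f : MvPolynomial (Fin n) ℝ) (x : Fin n → ℝ) : ℕ∞ :=
  (MvPolynomial.aeval (fun i => MvPolynomial.X i + MvPolynomial.C (x i)) f :
    MvPolynomial (Fin n) ℝ).support.inf fun m => (m.degree : ℕ∞)

/-- `d` is a delineating polynomial for `f` at `α`: it is not nullified at `α`, and `f` is
order-invariant in each section and sector of `d` over `α`. -/
def IsDelineating (f : Poly (n + 1)) (α : Fin n → ℝ) (d : MvPolynomial (Fin (n + 1)) ℝ) : Prop :=
  slice d α ≠ 0 ∧ ∀ y z : ℝ, position (rootsOver {d} α) y = position (rootsOver {d} α) z →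
    orderAt (toReal f) (Fin.snoc (α := fun _ => ℝ) α y) =
      orderAt (toReal f) (Fin.snoc (α := fun _ => ℝ) α z)

end Lifting

/-- A projection and lifting CAD algorithm that uses McCallum's operator `P`.  Such algorithms
may differ in the trivial simplifications of the projection sets, in the choice of sample points,
and in the treatment of cells on which a basis polynomial is nullified: there the algorithm either
gives up (`none`) or lifts with a substitute set of polynomials. -/
structure PAlgorithm where
  proj : (n : ℕ) → Finset (Poly (n + 1)) → Finset (Poly n)
  proj_spec : ∀ n A, TrivEquiv (proj n A) (projP A)
  sampler : (n : ℕ) → Cell n → Finset ℝ → ℕ → ℝ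
  sampler_spec : ∀ n c S, ∀ j ∈ Finset.Icc 1 (2 * S.card + 1), position S (sampler n c S j) = j
  onNullified : (n : ℕ) → Finset (Poly (n + 1)) → Cell n →
    Option (Finset (MvPolynomial (Fin (n + 1)) ℝ))

namespace PAlgorithm

/-- The stack over `c` of the polynomials in `L`; the number of its cells is found at the sample
point of `c`. -/
noncomputable def stack (W : PAlgorithm) {n : ℕ} (c : Cell n)
    (L : Finset (MvPolynomial (Fin (n + 1)) ℝ)) : List (Cell (n + 1)) :=
  (List.finRange (2 * (rootsOver L c.sample).card + 1)).map
    fun k : Fin (2 * (rootsOver L c.sample).card + 1) =>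
    { index := Fin.snoc (α := fun _ => ℕ) c.index ((k : ℕ) + 1)
      sample := Fin.snoc (α := fun _ => ℝ) c.sample
        (W.sampler n c (rootsOver L c.sample) ((k : ℕ) + 1))
      region := {x | Fin.init x ∈ c.region ∧
        position (rootsOver L (Fin.init x)) (x (Fin.last n)) = (k : ℕ) + 1}
      sample_mem := by
        refine ⟨by simpa using c.sample_mem, ?_⟩
        have hk := k.isLt
        simpa using W.sampler_spec n c (rootsOver L c.sample) ((k : ℕ) + 1)
          (Finset.mem_Icc.2 ⟨by omega, by omega⟩) }

open scoped Classical in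
/-- The polynomials used to lift over `c`, given the basis `B` of the input. -/
noncomputable def liftSet (W : PAlgorithm) {n : ℕ} (B : Finset (Poly (n + 1))) (c : Cell n) :
    Option (Finset (MvPolynomial (Fin (n + 1)) ℝ)) :=
  if ∃ f ∈ B, NullifiedOn f c then W.onNullified n B c else some (realSet B)

/-- Replace every cell of `D` by the stack over it of the polynomials provided by `L`; the result
is `none` (failure) as soon as `L` fails on some cell. -/
noncomputable def lift (W : PAlgorithm) {n : ℕ} (D : List (Cell n))
    (L : Cell n → Option (Finset (MvPolynomial (Fin (n + 1)) ℝ))) :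
    Option (List (Cell (n + 1))) :=
  (D.mapM fun c => (L c).map (W.stack c)).map List.flatten

/-- The output of the algorithm on a set of `n`-variate polynomials; `none` is failure. -/
noncomputable def run (W : PAlgorithm) : (n : ℕ) → Finset (Poly n) → Option (List (Cell n))
  | 0, _ => some [Cell.point]
  | n + 1, A => (W.run n (W.proj n A)).bind fun D => W.lift D (W.liftSet (basis A))

open scoped Classical in
/-- `W` is the algorithm `CADW`, for some choice of delineating polynomials: if a basis polynomial
is nullified on `c`, then it fails when `c` has positive dimension, and otherwise it replaces every
nullified basis polynomial by a delineating polynomial. -/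
def IsCADW (W : PAlgorithm) : Prop :=
  ∀ (n : ℕ) (B : Finset (Poly (n + 1))) (c : Cell n), (∃ f ∈ B, NullifiedOn f c) →
    (0 < c.dim → W.onNullified n B c = none) ∧
    (c.dim = 0 → ∃ d : Poly (n + 1) → MvPolynomial (Fin (n + 1)) ℝ,
      (∀ f ∈ B, NullifiedOn f c → IsDelineating f c.sample (d f)) ∧
      W.onNullified n B c = some (B.image fun f => if NullifiedOn f c then d f else toReal f))

/-- `W` chooses the sample points as `K` does and, on a cell on which a basis polynomial is
nullified, either gives up or proceeds as `K` does. -/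
def Follows (W K : PAlgorithm) : Prop :=
  W.sampler = K.sampler ∧
    ∀ (n : ℕ) (B : Finset (Poly (n + 1))) (c : Cell n),
      W.onNullified n B c = none ∨ W.onNullified n B c = K.onNullified n B c

end PAlgorithm

section Algorithm1

variable {n t : ℕ}

/-- The bases `Fᵢ`. -/
noncomputable def basisF (φ : Fin t → Clause n) (i : Fin t) : Finset (Poly (n + 1)) :=
  basis (φ i).E

/-- The bases `Bᵢ`. -/
noncomputable def basisB (φ : Fin t → Clause n) (i : Fin t) : Finset (Poly (n + 1)) :=
  basis (φ i).A

open scoped Classical in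
/-- The projection set: all contents, and the reduced projection of `(Bᵢ)` with respect to
`(Fᵢ)`. -/
noncomputable def projSet (φ : Fin t → Clause n) : Finset (Poly n) :=
  (Finset.univ.biUnion fun i => (φ i).A.image cont) ∪ projTTI (basisF φ) (basisB φ)

open scoped Classical in
/-- The lifting set over the cell `c`; `none` is failure. -/
noncomputable def ttiLiftSet (φ : Fin t → Clause n) (c : Cell n) :
    Option (Finset (MvPolynomial (Fin (n + 1)) ℝ)) :=
  if (∃ i, ∃ f ∈ (φ i).E, NullifiedOn f c) ∧ 0 < c.dim then none
  else some (realSet (Finset.univ.biUnion fun i =>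
    if ∃ f ∈ (φ i).E, NullifiedOn f c then basisB φ i else basisF φ i))

open scoped Classical in
/-- The TTICAD algorithm, with `W` as the subalgorithm that builds the CAD of the space of one
dimension less. -/
noncomputable def ttiAlgorithm (W : PAlgorithm) :
    (n : ℕ) → (Fin t → Clause n) → Option (List (Cell (n + 1)))
  | 0, φ => some (W.stack Cell.point (realSet (Finset.univ.biUnion (basisF φ))))
  | n + 1, φ => (W.run (n + 1) (projSet φ)).bind fun D => W.lift D (ttiLiftSet φ)

end Algorithm1

end TTICAD

/-! A resultant adjoined in the ResCAD set is free of the main variable: its primitive part is a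
unit, so it adds nothing to the basis, and its content is itself up to sign. Hence the basis is the
union of the `basisF φ i`, and applying `projP` turns the adjoined resultants into exactly the
constraint resultants of Algorithm 1. Its cross resultants are those of pairs from different `basisF
φ i`, and all other contents are 1. So both projection sets agree up to constants and signs
(`trivEquiv_projP_resCAD`). Such differences never reach the output: `TrivEquiv` sets have the same
basis and `TrivEquiv` projections, at every level (`run_congr`). Without nullification both
procedures then lift with the same polynomials (`liftSet_resCAD`, `ttiLiftSet_eq`). For the second
claim, a successful run of `W` took only steps that `K` also takes (`Follows.run_eq_some`); the
first claim for `K` finishes. -/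

namespace TTICAD

open UniqueFactorizationMonoid

/-! ### Equality up to constants and constant multiples. -/

section Constants

variable {n : ℕ}

theorem toMain_C (a : ℤ) :
    toMain ℤ n (MvPolynomial.C a) = Polynomial.C (MvPolynomial.C a) := by
  simp [toMain]

theorem toMain_embed (r : Poly n) : toMain ℤ n (embed r) = Polynomial.C r := by
  have h : ((toMain ℤ n).toAlgHom.comp (MvPolynomial.rename Fin.castSucc)) =
      (Polynomial.CAlgHom : Poly n →ₐ[ℤ] Polynomial (Poly n)) := by
    ext i : 1
    simp [toMain, MvPolynomial.optionEquivLeft_X_some, Polynomial.CAlgHom_apply]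
  exact DFunLike.congr_fun h r

theorem isUnit_iff_C {f : Poly n} : IsUnit f ↔ ∃ a : ℤ, IsUnit a ∧ f = MvPolynomial.C a :=
  MvPolynomial.isUnit_iff_eq_C_of_isReduced

theorem IsConstant.of_isUnit {f : Poly n} (hf : IsUnit f) : IsConstant f := by
  obtain ⟨a, -, rfl⟩ := isUnit_iff_C.1 hf
  exact ⟨a, rfl⟩

theorem ConstMultiple.refl (p : Poly n) : ConstMultiple p p := ⟨1, 1, one_ne_zero, one_ne_zero, rfl⟩

theorem ConstMultiple.symm {p q : Poly n} (h : ConstMultiple p q) : ConstMultiple q p := by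
  obtain ⟨a, b, ha, hb, h⟩ := h
  exact ⟨b, a, hb, ha, h.symm⟩

theorem ConstMultiple.trans {p q r : Poly n} (h : ConstMultiple p q) (h' : ConstMultiple q r) :
    ConstMultiple p r := by
  obtain ⟨a, b, ha, hb, h⟩ := h
  obtain ⟨c, d, hc, hd, h'⟩ := h'
  refine ⟨c * a, b * d, mul_ne_zero hc ha, mul_ne_zero hb hd, ?_⟩
  rw [MvPolynomial.C_mul, MvPolynomial.C_mul, mul_assoc, h, mul_left_comm, h', mul_assoc]

theorem ConstMultiple.of_associated {p q : Poly n} (h : Associated p q) : ConstMultiple p q := by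
  obtain ⟨u, rfl⟩ := h
  obtain ⟨a, ha, hu⟩ := isUnit_iff_C.1 u.isUnit
  exact ⟨a, 1, ha.ne_zero, one_ne_zero, by rw [hu, map_one, one_mul, mul_comm]⟩

/-- Compare coefficients at non-zero exponents. This makes `TrivEquiv` transitive: a non-constant
polynomial never passes through a constant, which the middle set might omit. -/
theorem IsConstant.of_constMultiple {p q : Poly n} (h : ConstMultiple p q) (hq : IsConstant q) :
    IsConstant p := by
  obtain ⟨a, b, ha, -, h⟩ := h
  obtain ⟨c, rfl⟩ := hq
  refine ⟨p.coeff 0, MvPolynomial.ext _ _ fun m => ?_⟩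
  by_cases hm : m = 0
  · rw [hm, MvPolynomial.coeff_C, if_pos rfl]
  · have := congrArg (MvPolynomial.coeff m) h
    rw [← MvPolynomial.C_mul, MvPolynomial.coeff_C_mul, MvPolynomial.coeff_C,
      if_neg (Ne.symm hm)] at this
    rw [MvPolynomial.coeff_C, if_neg (Ne.symm hm)]
    exact (mul_eq_zero.1 this).resolve_left ha

theorem TrivEquiv.refl (Q : Finset (Poly n)) : TrivEquiv Q Q :=
  ⟨fun q hq _ => ⟨q, hq, .refl q⟩, fun q hq _ => ⟨q, hq, .refl q⟩⟩

theorem TrivEquiv.symm {Q Q' : Finset (Poly n)} (h : TrivEquiv Q Q') : TrivEquiv Q' Q := by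
  refine ⟨fun q hq hc => ?_, fun q hq hc => ?_⟩
  · obtain ⟨q', hq', h'⟩ := h.2 q hq hc
    exact ⟨q', hq', h'.symm⟩
  · obtain ⟨q', hq', h'⟩ := h.1 q hq hc
    exact ⟨q', hq', h'.symm⟩

theorem TrivEquiv.exists_of_trans {Q Q' Q'' : Finset (Poly n)}
    (h : TrivEquiv Q Q') (h' : TrivEquiv Q' Q'') :
    ∀ q ∈ Q, ¬ IsConstant q → ∃ q' ∈ Q'', ConstMultiple q q' := by
  intro q hq hc
  obtain ⟨q', hq', e⟩ := h.1 q hq hc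
  obtain ⟨q'', hq'', e'⟩ := h'.1 q' hq' fun hc' => hc (hc'.of_constMultiple e)
  exact ⟨q'', hq'', e.trans e'⟩

theorem TrivEquiv.trans {Q Q' Q'' : Finset (Poly n)} (h : TrivEquiv Q Q')
    (h' : TrivEquiv Q' Q'') : TrivEquiv Q Q'' := by
  refine ⟨h.exists_of_trans h', fun q hq hc => ?_⟩
  obtain ⟨q', hq', e⟩ := h'.symm.exists_of_trans h.symm q hq hc
  exact ⟨q', hq', e.symm⟩

end Constants

/-! ### Invariance of basis and projection under trivial simplifications. -/

section Projection

variable {n : ℕ}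

theorem cont_embed (r : Poly n) : cont (embed r) = normalize r := by
  rw [cont, toMain_embed, Polynomial.content_C]

theorem isUnit_prim_embed (r : Poly n) : IsUnit (prim (embed r)) := by
  rw [prim, toMain_embed]
  exact (Polynomial.isUnit_primPart_C r).map (toMain ℤ n).symm

theorem embed_C (a : ℤ) : embed (MvPolynomial.C a : Poly n) = MvPolynomial.C a := by
  simp [embed]

theorem IsConstant.cont {f : Poly (n + 1)} (hf : IsConstant f) : IsConstant (cont f) := by
  obtain ⟨a, rfl⟩ := hf
  rw [← embed_C, cont_embed]
  exact IsConstant.of_constMultiple (ConstMultiple.of_associated (normalize_associated _)) ⟨a, rfl⟩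

theorem cont_C_mul_associated (a : ℤ) (f : Poly (n + 1)) :
    Associated (cont (MvPolynomial.C a * f)) (MvPolynomial.C a * cont f) := by
  rw [cont, map_mul, toMain_C]
  exact Polynomial.associated_content_C_mul _ _

theorem ConstMultiple.cont {f g : Poly (n + 1)} (h : ConstMultiple f g) :
    ConstMultiple (cont f) (cont g) := by
  obtain ⟨a, b, ha, hb, h⟩ := h
  have h₁ : ConstMultiple (TTICAD.cont f) (MvPolynomial.C a * TTICAD.cont f) :=
    ⟨a, 1, ha, one_ne_zero, by rw [map_one, one_mul]⟩
  have h₂ : ConstMultiple (TTICAD.cont g) (MvPolynomial.C b * TTICAD.cont g) :=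
    ⟨b, 1, hb, one_ne_zero, by rw [map_one, one_mul]⟩
  have h₃ := ConstMultiple.of_associated (cont_C_mul_associated a f)
  have h₄ := ConstMultiple.of_associated (cont_C_mul_associated b g)
  rw [h] at h₃
  exact h₁.trans (h₃.symm.trans (h₄.trans h₂.symm))

theorem prim_C_mul_associated {a : ℤ} (ha : a ≠ 0) (f : Poly (n + 1)) :
    Associated (prim (MvPolynomial.C a * f)) (prim f) := by
  -- Multiplicativity of the primitive part needs a non-zero product.
  by_cases hf : f = 0
  · rw [hf, mul_zero]
  have h0 : (Polynomial.C (MvPolynomial.C a) : Polynomial (Poly n)) * toMain ℤ n f ≠ 0 := by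
    refine mul_ne_zero ?_ ?_
    · simpa using ha
    · simpa using hf
  have h := (Polynomial.associated_primPart_mul h0).map (toMain ℤ n).symm
  rw [map_mul] at h
  rw [prim, map_mul, toMain_C]
  exact h.trans (associated_unit_mul_left _ _
    ((Polynomial.isUnit_primPart_C _).map (toMain ℤ n).symm))

theorem ConstMultiple.prim_associated {f g : Poly (n + 1)} (h : ConstMultiple f g) :
    Associated (prim f) (prim g) := by
  obtain ⟨a, b, ha, hb, h⟩ := h
  have h₁ := prim_C_mul_associated ha f
  rw [h] at h₁
  exact h₁.symm.trans (prim_C_mul_associated hb g)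

theorem mem_basis {A : Finset (Poly (n + 1))} {p : Poly (n + 1)} :
    p ∈ basis A ↔ ∃ f ∈ A, p ∈ normalizedFactors (prim f) := by
  simp only [basis, Finset.mem_biUnion, Multiset.mem_toFinset]

theorem normalizedFactors_prim_embed (r : Poly n) :
    normalizedFactors (prim (embed r)) = 0 :=
  normalizedFactors_of_isUnit (isUnit_prim_embed r)

/-- Constants, including 0, have unit primitive part and hence no factors; for the rest,
`normalizedFactors` sees only the associate class, so the bases coincide literally. -/
theorem TrivEquiv.basis_subset {Q Q' : Finset (Poly (n + 1))} (h : TrivEquiv Q Q') :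
    basis Q ⊆ basis Q' := by
  intro p hp
  obtain ⟨f, hf, hpf⟩ := mem_basis.1 hp
  by_cases hc : IsConstant f
  · obtain ⟨a, rfl⟩ := hc
    rw [← embed_C, normalizedFactors_prim_embed] at hpf
    simp at hpf
  · obtain ⟨g, hg, e⟩ := h.1 f hf hc
    refine mem_basis.2 ⟨g, hg, ?_⟩
    rwa [← e.prim_associated.normalizedFactors_eq]

theorem TrivEquiv.basis_eq {Q Q' : Finset (Poly (n + 1))} (h : TrivEquiv Q Q') :
    basis Q = basis Q' :=
  h.basis_subset.antisymm h.symm.basis_subset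

theorem TrivEquiv.exists_of_mem_projP {Q Q' : Finset (Poly (n + 1))} (h : TrivEquiv Q Q') :
    ∀ q ∈ projP Q, ¬ IsConstant q → ∃ q' ∈ projP Q', ConstMultiple q q' := by
  classical
  intro q hq hc
  rw [projP, Finset.mem_union, Finset.mem_image] at hq
  rcases hq with ⟨f, hf, rfl⟩ | hq
  · obtain ⟨g, hg, e⟩ := h.1 f hf fun hf' => hc hf'.cont
    exact ⟨cont g, Finset.mem_union_left _ (Finset.mem_image_of_mem _ hg), e.cont⟩
  · rw [h.basis_eq] at hq
    exact ⟨q, Finset.mem_union_right _ hq, ConstMultiple.refl q⟩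

theorem TrivEquiv.projP {Q Q' : Finset (Poly (n + 1))} (h : TrivEquiv Q Q') :
    TrivEquiv (projP Q) (projP Q') := by
  refine ⟨h.exists_of_mem_projP, fun q hq hc => ?_⟩
  obtain ⟨q', hq', e⟩ := h.symm.exists_of_mem_projP q hq hc
  exact ⟨q', hq', e.symm⟩

end Projection

/-! ### Comparison of runs of two algorithms. -/

namespace PAlgorithm

theorem Follows.refl (W : PAlgorithm) : W.Follows W := ⟨rfl, fun _ _ _ => Or.inr rfl⟩

theorem stack_congr {W K : PAlgorithm} (h : W.sampler = K.sampler) {n : ℕ} (c : Cell n)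
    (L : Finset (MvPolynomial (Fin (n + 1)) ℝ)) : W.stack c L = K.stack c L := by
  -- Destructuring makes the samplers variables, so their equation can be substituted although the
  -- `sample_mem` proofs depend on them.
  cases W
  cases K
  cases h
  rfl

theorem Follows.liftSet_eq {W K : PAlgorithm} (h : W.Follows K) {n : ℕ}
    (B : Finset (Poly (n + 1))) (c : Cell n) {L : Finset (MvPolynomial (Fin (n + 1)) ℝ)}
    (hL : W.liftSet B c = some L) : K.liftSet B c = some L := by
  unfold liftSet at hL ⊢
  split_ifs at hL ⊢ with hB
  · rcases h.2 n B c with h | h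
    · rw [h] at hL
      cases hL
    · rwa [← h]
  · exact hL

/-- One failure makes the whole map fail, so success of `f` on the list means success on each entry,
where `g` agrees. -/
theorem mapM_option_eq_some_of_imp {α β : Type*} {f g : α → Option β} :
    ∀ {l : List α} {r : List β}, (∀ a ∈ l, ∀ b, f a = some b → g a = some b) →
      l.mapM f = some r → l.mapM g = some r
  | [], r, _, h => by simpa using h
  | a :: l, r, hfg, h => by
    simp only [List.mapM_cons, Option.bind_eq_bind, Option.bind_eq_some_iff,
      Option.pure_def] at h ⊢
    obtain ⟨b, hb, s, hs, hr⟩ := h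
    exact ⟨b, hfg a (by simp) b hb, s,
      mapM_option_eq_some_of_imp (fun a' ha' => hfg a' (by simp [ha'])) hs, hr⟩

theorem lift_eq_some_of_imp {W K : PAlgorithm} (h : W.sampler = K.sampler) {n : ℕ}
    {D : List (Cell n)} {L L' : Cell n → Option (Finset (MvPolynomial (Fin (n + 1)) ℝ))}
    (hL : ∀ c ∈ D, ∀ S, L c = some S → L' c = some S) {D' : List (Cell (n + 1))}
    (hD : W.lift D L = some D') : K.lift D L' = some D' := by
  simp only [lift, Option.map_eq_some_iff] at hD ⊢
  obtain ⟨r, hr, rfl⟩ := hD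
  refine ⟨r, mapM_option_eq_some_of_imp (fun c hc b hb => ?_) hr, rfl⟩
  obtain ⟨S, hS, rfl⟩ := Option.map_eq_some_iff.1 hb
  rw [hL c hc S hS, Option.map_some, stack_congr h]

/-- If `W` succeeds, then every algorithm that it follows has the same output, on every input that
differs only by trivial simplifications. -/
theorem Follows.run_eq_some {W K : PAlgorithm} (h : W.Follows K) :
    ∀ {n : ℕ} {Q Q' : Finset (Poly n)}, TrivEquiv Q Q' → ∀ {D : List (Cell n)},
      W.run n Q = some D → K.run n Q' = some D
  | 0, _, _, _, _, hD => hD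
  | n + 1, Q, Q', hQ, D, hD => by
    rw [run, Option.bind_eq_some_iff] at hD ⊢
    obtain ⟨D', hD', hD⟩ := hD
    -- `W` and `K` may simplify their projections differently; both stay equivalent to `projP`.
    refine ⟨D', h.run_eq_some (((W.proj_spec n Q).trans hQ.projP).trans
      (K.proj_spec n Q').symm) hD', lift_eq_some_of_imp h.1 (fun c _ S hS => ?_) hD⟩
    rw [← hQ.basis_eq]
    exact h.liftSet_eq _ c hS

theorem run_congr (W : PAlgorithm) {n : ℕ} {Q Q' : Finset (Poly n)} (h : TrivEquiv Q Q') :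
    W.run n Q = W.run n Q' :=
  Option.ext fun _ => ⟨(Follows.refl W).run_eq_some h, (Follows.refl W).run_eq_some h.symm⟩

end PAlgorithm

/-! ### Irreducible bases, normalization and resultants. -/

section IrreducibleBasis

variable {n : ℕ}

theorem isPrimitive_toMain {f : Poly (n + 1)} (hf : Irreducible f) (hd : 0 < mainDegree f) :
    (toMain ℤ n f).IsPrimitive :=
  Irreducible.isPrimitive ((MulEquiv.irreducible_iff (toMain ℤ n)).2 hf) hd.ne'

theorem prim_eq_self {f : Poly (n + 1)} (hf : Irreducible f) (hd : 0 < mainDegree f) :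
    prim f = f := by
  rw [prim, (isPrimitive_toMain hf hd).primPart_eq, AlgEquiv.symm_apply_apply]

theorem cont_eq_one {f : Poly (n + 1)} (hf : Irreducible f) (hd : 0 < mainDegree f) :
    cont f = 1 :=
  (isPrimitive_toMain hf hd).content_eq_one

theorem mem_basis_of_irreducible {A : Finset (Poly (n + 1))} (hd : ∀ f ∈ A, 0 < mainDegree f)
    (hA : ∀ f ∈ A, Irreducible f) {p : Poly (n + 1)} :
    p ∈ basis A ↔ ∃ f ∈ A, normalize f = p := by
  rw [mem_basis]
  refine exists_congr fun f => and_congr_right fun hf => ?_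
  rw [prim_eq_self (hA f hf) (hd f hf), normalizedFactors_irreducible (hA f hf),
    Multiset.mem_singleton, eq_comm]

theorem IsIrreducibleBasis.mono {A E : Finset (Poly (n + 1))} (hA : IsIrreducibleBasis A)
    (h : E ⊆ A) : IsIrreducibleBasis E :=
  ⟨fun f hf => hA.pos_degree f (h hf), fun f hf => hA.irreducible f (h hf),
    fun f hf g hg => hA.relPrime f (h hf) g (h hg)⟩

theorem IsIrreducibleBasis.mem_basis_iff {A : Finset (Poly (n + 1))} (hA : IsIrreducibleBasis A)
    {p : Poly (n + 1)} : p ∈ basis A ↔ ∃ f ∈ A, normalize f = p :=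
  mem_basis_of_irreducible hA.pos_degree hA.irreducible

theorem IsIrreducibleBasis.eq_of_normalize_eq {A : Finset (Poly (n + 1))}
    (hA : IsIrreducibleBasis A) {f g : Poly (n + 1)} (hf : f ∈ A) (hg : g ∈ A)
    (h : normalize f = normalize g) : f = g := by
  by_contra hne
  have h' : Associated f g := by
    rwa [normalize_eq_normalize_iff_associated] at h
  exact (hA.irreducible f hf).not_isUnit (hA.relPrime f hf g hg hne dvd_rfl h'.dvd)

open scoped Classical in
-- Normalization is injective on `A`, since distinct associates would be coprime irreducibles; hence
-- it commutes with the set difference.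
theorem IsIrreducibleBasis.mem_basis_sdiff {A E : Finset (Poly (n + 1))}
    (hA : IsIrreducibleBasis A) (hE : E ⊆ A) {p : Poly (n + 1)} :
    p ∈ basis A \ basis E ↔ ∃ g ∈ A \ E, normalize g = p := by
  rw [Finset.mem_sdiff, hA.mem_basis_iff, (hA.mono hE).mem_basis_iff]
  constructor
  · rintro ⟨⟨g, hg, rfl⟩, h⟩
    exact ⟨g, Finset.mem_sdiff.2 ⟨hg, fun hg' => h ⟨g, hg', rfl⟩⟩, rfl⟩
  · rintro ⟨g, hg, rfl⟩
    rw [Finset.mem_sdiff] at hg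
    refine ⟨⟨g, hg.1, rfl⟩, ?_⟩
    rintro ⟨f, hf, h⟩
    exact hg.2 (hA.eq_of_normalize_eq (hE hf) hg.1 h ▸ hf)

theorem res_comm_associated (f g : Poly (n + 1)) : Associated (res f g) (res g f) := by
  rw [res, Polynomial.resultant_comm, res]
  exact associated_unit_mul_left _ _ (isUnit_one.neg.pow _)

theorem res_associated_of_left {f f' : Poly (n + 1)} (h : Associated f f') (g : Poly (n + 1)) :
    Associated (res f g) (res f' g) := by
  obtain ⟨u, rfl⟩ := h
  obtain ⟨a, ha, hu⟩ := isUnit_iff_C.1 u.isUnit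
  have hC : IsUnit (MvPolynomial.C a : Poly n) := ha.map MvPolynomial.C
  rw [res, res, hu, mul_comm f, map_mul, toMain_C,
    -- The resultant takes its formal degrees from `natDegree`, which must first be seen to be
    -- unchanged by the unit.
    Polynomial.natDegree_C_mul hC.ne_zero, Polynomial.resultant_C_mul_left]
  exact (associated_unit_mul_left _ _ (hC.pow _)).symm

theorem res_associated {f f' g g' : Poly (n + 1)} (hf : Associated f f') (hg : Associated g g') :
    Associated (res f g) (res f' g') :=
  (res_associated_of_left hf g).trans <| (res_comm_associated f' g).trans <|
    (res_associated_of_left hg f').trans (res_comm_associated g' f')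

theorem nullifiedAt_congr {f g : Poly (n + 1)} (h : Associated f g) (α : Fin n → ℝ)
    (hf : NullifiedAt f α) : NullifiedAt g α := by
  obtain ⟨u, rfl⟩ := h
  rw [NullifiedAt, slice, toReal, map_mul, map_mul, Polynomial.map_mul]
  rw [NullifiedAt, slice, toReal] at hf
  rw [hf, zero_mul]

end IrreducibleBasis

/-! ### The ResCAD set against Algorithm 1. -/

section ResCAD

variable {n t : ℕ}

theorem Clause.E_subset_A (φ : Clause n) : φ.E ⊆ φ.A := by
  intro f hf
  unfold Clause.E at hf
  split at hf
  · next g hg =>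
    rw [Finset.mem_singleton] at hf
    subst hf
    exact φ.ec_mem f hg
  · exact hf

open scoped Classical in
theorem mem_resCAD {φ : Fin t → Clause n} {p : Poly (n + 1)} :
    p ∈ resCAD φ ↔ (∃ i, p ∈ (φ i).E) ∨
      ∃ i, ∃ f ∈ (φ i).E, ∃ g ∈ (φ i).A \ (φ i).E, embed (res f g) = p := by
  simp only [resCAD, Finset.mem_union, Finset.mem_biUnion, Finset.mem_univ, true_and,
    Finset.mem_image, Finset.mem_product, Prod.exists]
  refine or_congr Iff.rfl (exists_congr fun i => ?_)
  constructor
  · rintro ⟨f, g, ⟨hf, hg⟩, h⟩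
    exact ⟨f, hf, g, hg, h⟩
  · rintro ⟨f, hf, g, hg, h⟩
    exact ⟨f, g, ⟨hf, hg⟩, h⟩

open scoped Classical in
theorem basis_resCAD (φ : Fin t → Clause n) :
    basis (resCAD φ) = Finset.univ.biUnion (basisF φ) := by
  ext p
  simp only [Finset.mem_biUnion, Finset.mem_univ, true_and, basisF, mem_basis, mem_resCAD]
  constructor
  · rintro ⟨f, ⟨i, hf⟩ | ⟨i, f, -, g, -, rfl⟩, hp⟩
    · exact ⟨i, f, hf, hp⟩
    · rw [normalizedFactors_prim_embed] at hp
      simp at hp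
  · rintro ⟨i, f, hf, hp⟩
    exact ⟨f, Or.inl ⟨i, hf⟩, hp⟩

theorem mem_resSet {A B : Finset (Poly (n + 1))} {r : Poly n} :
    r ∈ resSet A B ↔ ∃ f ∈ A, ∃ g ∈ B, f ≠ g ∧ res f g = r := by
  simp only [resSet, Finset.mem_image, Finset.mem_filter, Finset.mem_product, Prod.exists]
  constructor
  · rintro ⟨f, g, ⟨⟨hf, hg⟩, hne⟩, h⟩
    exact ⟨f, hf, g, hg, hne, h⟩
  · rintro ⟨f, hf, g, hg, hne, h⟩
    exact ⟨f, g, ⟨⟨hf, hg⟩, hne⟩, h⟩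

theorem mem_projBasis {B : Finset (Poly (n + 1))} {r : Poly n} :
    r ∈ projBasis B ↔ (∃ f ∈ B, r ∈ coeffs f) ∨ (∃ f ∈ B, disc f = r) ∨ r ∈ resSet B B := by
  simp [projBasis]

open scoped Classical in
theorem mem_projTTI {E A : Fin t → Finset (Poly (n + 1))} {r : Poly n} :
    r ∈ projTTI E A ↔ (∃ i, r ∈ projBasis (E i)) ∨ (∃ i, r ∈ resSet (E i) (A i \ E i)) ∨
      ∃ i j, i < j ∧ r ∈ resSet (E i) (E j) := by
  simp [projTTI, projEC, crossRes, exists_or, or_assoc]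

theorem mem_projSet {φ : Fin t → Clause n} {r : Poly n} :
    r ∈ projSet φ ↔ (∃ i, ∃ f ∈ (φ i).A, cont f = r) ∨ r ∈ projTTI (basisF φ) (basisB φ) := by
  simp [projSet]

theorem mem_projP {A : Finset (Poly (n + 1))} {r : Poly n} :
    r ∈ projP A ↔ (∃ f ∈ A, cont f = r) ∨ r ∈ projBasis (basis A) := by
  simp [projP]

/-- McCallum's projection of a union of bases consists, up to trivial simplifications, of the
projections of the bases and of the cross resultants. -/
theorem exists_projTTI_of_mem_projBasis {E A : Fin t → Finset (Poly (n + 1))}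
    {B : Finset (Poly (n + 1))} (hB : ∀ f, f ∈ B ↔ ∃ i, f ∈ E i) {r : Poly n}
    (hr : r ∈ projBasis B) : ∃ r' ∈ projTTI E A, ConstMultiple r r' := by
  rw [mem_projBasis] at hr
  rcases hr with ⟨f, hf, hr⟩ | ⟨f, hf, hr⟩ | hr
  · obtain ⟨i, hf⟩ := (hB f).1 hf
    exact ⟨r, mem_projTTI.2 (Or.inl ⟨i, mem_projBasis.2 (Or.inl ⟨f, hf, hr⟩)⟩), .refl r⟩
  · obtain ⟨i, hf⟩ := (hB f).1 hf
    exact ⟨r, mem_projTTI.2 (Or.inl ⟨i, mem_projBasis.2 (Or.inr (Or.inl ⟨f, hf, hr⟩))⟩), .refl r⟩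
  · obtain ⟨f, hf, g, hg, hne, rfl⟩ := mem_resSet.1 hr
    obtain ⟨i, hf⟩ := (hB f).1 hf
    obtain ⟨j, hg⟩ := (hB g).1 hg
    rcases lt_trichotomy i j with hij | rfl | hij
    · exact ⟨_, mem_projTTI.2 (Or.inr (Or.inr ⟨i, j, hij, mem_resSet.2 ⟨f, hf, g, hg, hne, rfl⟩⟩)),
        .refl _⟩
    · exact ⟨_, mem_projTTI.2 (Or.inl ⟨i, mem_projBasis.2 (Or.inr (Or.inr
        (mem_resSet.2 ⟨f, hf, g, hg, hne, rfl⟩)))⟩), .refl _⟩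
    -- Cross resultants are listed only for increasing indices; swapping the arguments costs a sign.
    · exact ⟨_, mem_projTTI.2 (Or.inr (Or.inr ⟨j, i, hij,
        mem_resSet.2 ⟨g, hg, f, hf, hne.symm, rfl⟩⟩)), .of_associated (res_comm_associated f g)⟩

theorem projBasis_mono {B B' : Finset (Poly (n + 1))} (h : B ⊆ B') :
    projBasis B ⊆ projBasis B' := by
  intro r hr
  rw [mem_projBasis] at hr ⊢
  rcases hr with ⟨f, hf, hr⟩ | ⟨f, hf, hr⟩ | hr
  · exact Or.inl ⟨f, h hf, hr⟩
  · exact Or.inr (Or.inl ⟨f, h hf, hr⟩)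
  · obtain ⟨f, hf, g, hg, hne, hr⟩ := mem_resSet.1 hr
    exact Or.inr (Or.inr (mem_resSet.2 ⟨f, h hf, g, h hg, hne, hr⟩))

/-- McCallum's projection of the ResCAD set agrees with the projection set of the TTICAD
algorithm up to trivial simplifications. -/
theorem trivEquiv_projP_resCAD (φ : Fin t → Clause n)
    (hbasis : ∀ i, IsIrreducibleBasis (φ i).A) :
    TrivEquiv (projP (resCAD φ)) (projSet φ) := by
  classical
  have hmem : ∀ f, f ∈ basis (resCAD φ) ↔ ∃ i, f ∈ basisF φ i := fun f => by
    simp [basis_resCAD]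
  have hcont : ∀ i, ∀ f ∈ (φ i).A, IsConstant (cont f) := fun i f hf => by
    rw [cont_eq_one ((hbasis i).irreducible f hf) ((hbasis i).pos_degree f hf)]
    exact .of_isUnit isUnit_one
  -- The adjoined resultants use the given polynomials, Algorithm 1 their normalized associates.
  have hres : ∀ f g : Poly (n + 1),
      ConstMultiple (cont (embed (res f g))) (res (normalize f) (normalize g)) := fun f g => by
    rw [cont_embed]
    exact .of_associated ((normalize_associated _).trans
      (res_associated (associated_normalize f) (associated_normalize g)))
  refine ⟨fun q hq hc => ?_, fun q hq hc => ?_⟩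
  · rcases mem_projP.1 hq with ⟨p, hp, rfl⟩ | hq
    · rcases mem_resCAD.1 hp with ⟨i, hf⟩ | ⟨i, f, hf, g, hg, rfl⟩
      · exact absurd (hcont i p ((φ i).E_subset_A hf)) hc
      · have hf' : normalize f ∈ basisF φ i :=
          ((hbasis i).mono (φ i).E_subset_A).mem_basis_iff.2 ⟨f, hf, rfl⟩
        have hg' : normalize g ∈ basisB φ i \ basisF φ i :=
          ((hbasis i).mem_basis_sdiff (φ i).E_subset_A).2 ⟨g, hg, rfl⟩
        refine ⟨_, mem_projSet.2 (Or.inr (mem_projTTI.2 (Or.inr (Or.inl ⟨i, mem_resSet.2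
          ⟨_, hf', _, hg', ?_, rfl⟩⟩)))), hres f g⟩
        intro h
        exact (Finset.mem_sdiff.1 hg').2 (h ▸ hf')
    · obtain ⟨q', hq', e⟩ := exists_projTTI_of_mem_projBasis (A := basisB φ) hmem hq
      exact ⟨q', mem_projSet.2 (Or.inr hq'), e⟩
  · rcases mem_projSet.1 hq with ⟨i, f, hf, rfl⟩ | hq
    · exact absurd (hcont i f hf) hc
    rcases mem_projTTI.1 hq with ⟨i, hq⟩ | ⟨i, hq⟩ | ⟨i, j, -, hq⟩
    · exact ⟨q, mem_projP.2 (Or.inr (projBasis_mono (fun f hf => (hmem f).2 ⟨i, hf⟩) hq)),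
        .refl q⟩
    · obtain ⟨p, hp, p', hp', -, rfl⟩ := mem_resSet.1 hq
      obtain ⟨f, hf, rfl⟩ := ((hbasis i).mono (φ i).E_subset_A).mem_basis_iff.1 hp
      obtain ⟨g, hg, rfl⟩ := ((hbasis i).mem_basis_sdiff (φ i).E_subset_A).1 hp'
      exact ⟨_, mem_projP.2 (Or.inl ⟨_, mem_resCAD.2 (Or.inr ⟨i, f, hf, g, hg, rfl⟩), rfl⟩),
        hres f g⟩
    · obtain ⟨f, hf, g, hg, hne, rfl⟩ := mem_resSet.1 hq
      exact ⟨_, mem_projP.2 (Or.inr (mem_projBasis.2 (Or.inr (Or.inr (mem_resSet.2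
        ⟨f, (hmem f).2 ⟨i, hf⟩, g, (hmem g).2 ⟨j, hg⟩, hne, rfl⟩))))), .refl _⟩

open scoped Classical in
theorem liftSet_resCAD (W : PAlgorithm) (φ : Fin t → Clause n)
    (hbasis : ∀ i, IsIrreducibleBasis (φ i).A)
    (hnull : ∀ i, ∀ f ∈ (φ i).E, ∀ α : Fin n → ℝ, ¬ NullifiedAt f α) (c : Cell n) :
    W.liftSet (basis (resCAD φ)) c = some (realSet (Finset.univ.biUnion (basisF φ))) := by
  rw [PAlgorithm.liftSet, if_neg, basis_resCAD]
  rintro ⟨p, hp, hpc⟩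
  rw [basis_resCAD, Finset.mem_biUnion] at hp
  obtain ⟨i, -, hp⟩ := hp
  obtain ⟨f, hf, rfl⟩ := ((hbasis i).mono (φ i).E_subset_A).mem_basis_iff.1 hp
  -- The sample point witnesses that the region is non-empty, so nullification on `c` would give a
  -- nullified point.
  exact hnull i f hf c.sample
    (nullifiedAt_congr (normalize_associated f) _ (hpc _ c.sample_mem))

open scoped Classical in
theorem ttiLiftSet_eq (φ : Fin t → Clause n)
    (hnull : ∀ i, ∀ f ∈ (φ i).E, ∀ α : Fin n → ℝ, ¬ NullifiedAt f α) (c : Cell n) :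
    ttiLiftSet φ c = some (realSet (Finset.univ.biUnion (basisF φ))) := by
  have h : ∀ i, ¬ ∃ f ∈ (φ i).E, NullifiedOn f c := fun i ⟨f, hf, hfc⟩ =>
    hnull i f hf c.sample (hfc _ c.sample_mem)
  rw [ttiLiftSet, if_neg fun h' => let ⟨i, hi⟩ := h'.1; h i hi]
  simp only [if_neg (h _)]

theorem run_resCAD_eq_ttiAlgorithm (W : PAlgorithm) :
    ∀ {n : ℕ} (φ : Fin t → Clause n), (∀ i, IsIrreducibleBasis (φ i).A) →
      (∀ i, ∀ f ∈ (φ i).E, ∀ α : Fin n → ℝ, ¬ NullifiedAt f α) →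
      W.run (n + 1) (resCAD φ) = ttiAlgorithm W n φ
  | 0, φ, hbasis, hnull => by
    simp [PAlgorithm.run, PAlgorithm.lift, ttiAlgorithm, liftSet_resCAD W φ hbasis hnull]
  | n + 1, φ, hbasis, hnull => by
    rw [PAlgorithm.run, ttiAlgorithm, W.run_congr
      ((W.proj_spec (n + 1) (resCAD φ)).trans (trivEquiv_projP_resCAD φ hbasis))]
    refine congrArg _ (funext fun D => congrArg (W.lift D) (funext fun c => ?_))
    rw [liftSet_resCAD W φ hbasis hnull, ttiLiftSet_eq φ hnull]

end ResCAD

end TTICAD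

open TTICAD in
theorem corollary4p3 {n t : ℕ} (φ : Fin t → Clause n)
    (hbasis : ∀ i, IsIrreducibleBasis (φ i).A)
    (hnull : ∀ i, ∀ f ∈ (φ i).E, ∀ α : Fin n → ℝ, ¬ NullifiedAt f α) :
    (∀ W : PAlgorithm, W.run (n + 1) (resCAD φ) = ttiAlgorithm W n φ) ∧
    (∀ W K : PAlgorithm, K.IsCADW → W.Follows K →
      ∀ D, W.run (n + 1) (resCAD φ) = some D → ttiAlgorithm K n φ = some D) := by
  refine ⟨fun W => run_resCAD_eq_ttiAlgorithm W φ hbasis hnull, fun W K _ hWK D hD => ?_⟩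
  -- Both runs now have the same input, so only `W` and `K` remain to be compared.
  rw [← run_resCAD_eq_ttiAlgorithm K φ hbasis hnull]
  exact hWK.run_eq_some (.refl _) hD
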